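/- Let $d \ge 0$ be an integer and let $r > 0$. Let $a$ be a random vector in $\mathbb{R}^d$ with independent standard normal entries, let $b$ be independent of $a$ and uniformly distributed on $[0,r]$, and let $h(x) = \lfloor (\langle a, x\rangle + b)/r \rfloor$ for $x \in \mathbb{R}^d$. The L2 LSH kernel with bucket width $r$ is the collision probability $$\mathcal{K}(x,y) = \Pr[h(x) = h(y)], \qquad x, y \in \mathbb{R}^d .$$ Then: 1. $\mathcal{K}$ is shift-invariant: there is a function $k : \mathbb{R}^d \to \mathbb{R}$ with $\mathcal{K}(x,y) = k(x-y)$ for all $x, y$. 2. $\mathcal{K}$ is universal: it is continuous on $\mathbb{R}^d \times \mathbb{R}^d$ and, for every compact set $\mathcal{X} \subseteq \mathbb{R}^d$, its restriction to $\mathcal{X} \times \mathcal{X}$ is positive semidefinite, and the reproducing kernel Hilbert space of functions on $\mathcal{X}$ that it induces consists of continuous functions and is dense in the space $C(\mathcal{X})$ of continuous real functions on $\mathcal{X}$ with the uniform norm. Moreover, for every compact $\mathcal{X} \subseteq \mathbb{R}^d$, the finite linear combinations $\sum_{i} \alpha_i\, \mathcal{K}(\cdot, y_i)$ with $\alpha_i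 \in \mathbb{R}$ and $y_i \in \mathcal{X}$ are dense in $C(\mathcal{X})$ for the uniform norm. -/

import Mathlib

/-- The hash function of the Euclidean (2-stable) locality-sensitive hashing scheme with bucket
width `r`, direction `a` and offset `b`: `x ↦ ⌊(⟨a, x⟩ + b) / r⌋`. -/
noncomputable def l2Hash {d : ℕ} (r : ℝ) (a : EuclideanSpace ℝ (Fin d)) (b : ℝ)
    (x : EuclideanSpace ℝ (Fin d)) : ℤ :=
  ⌊(inner ℝ a x + b) / r⌋

/-- The law of the random parameters `(a, b)` of the hash function: the entries of `a` are
independent standard normal variables, and `b` is independent of `a` and uniform on `[0, r]`. -/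
noncomputable def l2HashLaw (d : ℕ) (r : ℝ) :
    MeasureTheory.Measure (EuclideanSpace ℝ (Fin d) × ℝ) :=
  (ProbabilityTheory.stdGaussian (EuclideanSpace ℝ (Fin d))).prod
    (ProbabilityTheory.cond MeasureTheory.volume (Set.Icc 0 r))

/-- The L2 LSH kernel: the collision probability `Pr[h(x) = h(y)]` of the random hash function. -/
noncomputable def l2LSHKernel (d : ℕ) (r : ℝ) (x y : EuclideanSpace ℝ (Fin d)) : ℝ :=
  (l2HashLaw d r).real {p | l2Hash r p.1 p.2 x = l2Hash r p.1 p.2 y}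

/-- A kernel on a vector space is shift-invariant if `K x y` is a function of `x - y`. -/
def IsShiftInvariantKernel {E : Type*} [AddCommGroup E] (K : E → E → ℝ) : Prop :=
  ∃ k : E → ℝ, ∀ x y, K x y = k (x - y)

/-- The restriction of a real kernel to a set `S`, as a matrix of operators on `ℝ`
(the entry at `(x, y)` is multiplication by `K x y`). -/
noncomputable def kernelMatrix {E : Type*} (K : E → E → ℝ) (S : Set E) :
    Matrix S S (ℝ →L[ℝ] ℝ) :=
  Matrix.of fun x y => K x y • ContinuousLinearMap.id ℝ ℝ

/-- The continuous functions on `S` that belong to the reproducing kernel Hilbert space of functions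
on `S` induced by the kernel `K` (which exists because `K` is positive semidefinite on `S`). -/
def rkhsFunctions {E : Type*} [TopologicalSpace E] (K : E → E → ℝ) (S : Set E)
    (hK : (kernelMatrix K S).PosSemidef) : Set C(S, ℝ) :=
  haveI : Fact (kernelMatrix K S).PosSemidef := ⟨hK⟩
  {g | ∃ f : RKHS.OfKernel (kernelMatrix K S), ∀ x : S, g x = f x}

/-- A kernel `K` on `E` is universal if it is continuous and, for every compact `S ⊆ E`, its
restriction to `S` is positive semidefinite, the reproducing kernel Hilbert space it induces consists
of continuous functions on `S`, and this space is dense in `C(S, ℝ)` for the uniform norm. -/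
def IsUniversalKernel {E : Type*} [TopologicalSpace E] (K : E → E → ℝ) : Prop :=
  Continuous (fun p : E × E => K p.1 p.2) ∧
    ∀ S : Set E, IsCompact S →
      ∃ hK : (kernelMatrix K S).PosSemidef,
        (haveI : Fact (kernelMatrix K S).PosSemidef := ⟨hK⟩
          ∀ f : RKHS.OfKernel (kernelMatrix K S), Continuous fun x : S => f x) ∧
        Dense (rkhsFunctions K S hK)

/-- The finite linear combinations `∑ αᵢ K(·, yᵢ)` with centres `yᵢ ∈ S`, as continuous functions
on `S`. -/
def kernelSpan {E : Type*} [TopologicalSpace E] (K : E → E → ℝ) (S : Set E) : Set C(S, ℝ) :=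
  {g | ∃ α : S →₀ ℝ, ∀ x : S, g x = α.sum fun y c => c * K x y}

/-! Given `a`, two points share a cell of the randomly shifted grid with probability `triangle r ⟪a,
x - y⟫` (`cond_floor_eq_floor`); averaging over `a` gives shift-invariance. The triangle is a
superposition of cosines with a nonnegative integrable density of Fejér type
(`triangle_eq_integral_cos`), so the kernel is `∫ cos ⟪ω, x - y⟫ dμ(ω)` for a finite measure `μ`,
the image of density × Gaussian under `(s, a) ↦ 2πs a`. It has full support because the density is
positive near one nonzero `s` and the Gaussian charges every open set.

Such a representation makes quadratic forms integrals of squares, hence nonnegative. For density,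
let a functional `L` on `C(S, ℝ)` kill all sections, and write `c_ω`, `s_ω` for the cosine and sine
features. Then `∫ (L(c_ω) c_ω + L(s_ω) s_ω) dμ` is the zero function, and applying `L` gives `∫
(L(c_ω)² + L(s_ω)²) dμ = 0`. By continuity and full support `L` kills every trigonometric
polynomial, so `L = 0` by Stone–Weierstrass. Working with `L` directly avoids representing it by a
signed measure. The sections lie in the RKHS, so it is dense too. -/

open MeasureTheory Filter Topology
open scoped RealInnerProductSpace FourierTransform

/-! ### Trigonometric polynomials and duality -/

section Trig
variable {E : Type*} [NormedAddCommGroup E] [InnerProductSpace ℝ E]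

/-- The function `x ↦ cos ⟪ω, x⟫` on a set `S`. -/
noncomputable def cosFeature (S : Set E) (ω : E) : C(S, ℝ) :=
  ⟨fun x => Real.cos ⟪ω, (x : E)⟫, by fun_prop⟩

/-- The function `x ↦ sin ⟪ω, x⟫` on a set `S`. -/
noncomputable def sinFeature (S : Set E) (ω : E) : C(S, ℝ) :=
  ⟨fun x => Real.sin ⟪ω, (x : E)⟫, by fun_prop⟩

@[simp] lemma cosFeature_apply (S : Set E) (ω : E) (x : S) :
    cosFeature S ω x = Real.cos ⟪ω, (x : E)⟫ := rfl

@[simp] lemma sinFeature_apply (S : Set E) (ω : E) (x : S) :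
    sinFeature S ω x = Real.sin ⟪ω, (x : E)⟫ := rfl

lemma continuous_cosFeature (S : Set E) : Continuous (cosFeature S) := by
  refine ContinuousMap.continuous_of_continuous_uncurry _ ?_
  change Continuous fun p : E × S => Real.cos ⟪p.1, (p.2 : E)⟫
  fun_prop

lemma continuous_sinFeature (S : Set E) : Continuous (sinFeature S) := by
  refine ContinuousMap.continuous_of_continuous_uncurry _ ?_
  change Continuous fun p : E × S => Real.sin ⟪p.1, (p.2 : E)⟫
  fun_prop

/-- The trigonometric polynomials on `S`. -/
noncomputable def trigSpan (S : Set E) : Submodule ℝ C(S, ℝ) :=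
  Submodule.span ℝ (Set.range (cosFeature S) ∪ Set.range (sinFeature S))

lemma cosFeature_mem_trigSpan (S : Set E) (ω : E) : cosFeature S ω ∈ trigSpan S :=
  Submodule.subset_span (Or.inl ⟨ω, rfl⟩)

lemma sinFeature_mem_trigSpan (S : Set E) (ω : E) : sinFeature S ω ∈ trigSpan S :=
  Submodule.subset_span (Or.inr ⟨ω, rfl⟩)

lemma one_mem_trigSpan (S : Set E) : (1 : C(S, ℝ)) ∈ trigSpan S := by
  have : (1 : C(S, ℝ)) = cosFeature S 0 := by ext; simp
  exact this ▸ cosFeature_mem_trigSpan S 0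

/-- The product-to-sum formulas make the span an algebra, as Stone–Weierstrass requires. -/
lemma mul_mem_trigSpan (S : Set E) {f g : C(S, ℝ)} (hf : f ∈ trigSpan S) (hg : g ∈ trigSpan S) :
    f * g ∈ trigSpan S := by
  have key : trigSpan S * trigSpan S ≤ trigSpan S := by
    unfold trigSpan
    rw [Submodule.span_mul_span, Submodule.span_le]
    rintro _ ⟨_, ⟨a, rfl⟩ | ⟨a, rfl⟩, _, ⟨b, rfl⟩ | ⟨b, rfl⟩, rfl⟩
    · have : cosFeature S a * cosFeature S b =
          (1 / 2 : ℝ) • (cosFeature S (a - b) + cosFeature S (a + b)) := by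
        ext x
        simp [inner_add_left, inner_sub_left, Real.cos_add, Real.cos_sub]
        ring
      change cosFeature S a * cosFeature S b ∈ trigSpan S
      rw [this]
      exact Submodule.smul_mem _ _ (Submodule.add_mem _ (cosFeature_mem_trigSpan _ _)
        (cosFeature_mem_trigSpan _ _))
    · have : cosFeature S a * sinFeature S b =
          (1 / 2 : ℝ) • (sinFeature S (a + b) - sinFeature S (a - b)) := by
        ext x
        simp [inner_add_left, inner_sub_left, Real.sin_add, Real.sin_sub]
        ring
      change cosFeature S a * sinFeature S b ∈ trigSpan S
      rw [this]
      exact Submodule.smul_mem _ _ (Submodule.sub_mem _ (sinFeature_mem_trigSpan _ _)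
        (sinFeature_mem_trigSpan _ _))
    · have : sinFeature S a * cosFeature S b =
          (1 / 2 : ℝ) • (sinFeature S (a + b) + sinFeature S (a - b)) := by
        ext x
        simp [inner_add_left, inner_sub_left, Real.sin_add, Real.sin_sub]
        ring
      change sinFeature S a * cosFeature S b ∈ trigSpan S
      rw [this]
      exact Submodule.smul_mem _ _ (Submodule.add_mem _ (sinFeature_mem_trigSpan _ _)
        (sinFeature_mem_trigSpan _ _))
    · have : sinFeature S a * sinFeature S b =
          (1 / 2 : ℝ) • (cosFeature S (a - b) - cosFeature S (a + b)) := by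
        ext x
        simp [inner_add_left, inner_sub_left, Real.cos_add, Real.cos_sub]
        ring
      change sinFeature S a * sinFeature S b ∈ trigSpan S
      rw [this]
      exact Submodule.smul_mem _ _ (Submodule.sub_mem _ (cosFeature_mem_trigSpan _ _)
        (cosFeature_mem_trigSpan _ _))
  exact key (Submodule.mul_mem_mul hf hg)

/-- Trigonometric polynomials are dense in `C(S, ℝ)` for compact `S`. -/
lemma dense_trigSpan {S : Set E} (hS : IsCompact S) : Dense (trigSpan S : Set C(S, ℝ)) := by
  have : CompactSpace S := isCompact_iff_compactSpace.mp hS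
  let A : Subalgebra ℝ C(S, ℝ) := (trigSpan S).toSubalgebra (one_mem_trigSpan S)
    fun _ _ => mul_mem_trigSpan S
  have hA : A.SeparatesPoints := by
    intro x y hxy
    have hne : ⟪(x : E) - y, (x : E) - y⟫ ≠ 0 :=
      inner_self_ne_zero.mpr (sub_ne_zero.mpr fun h => hxy (Subtype.ext h))
    -- Scaled so that the phases at `x` and `y` differ by exactly `π`: sine and cosine both change
    -- sign, and one of them is nonzero at `y`.
    set ω : E := (Real.pi / ⟪(x : E) - y, (x : E) - y⟫) • ((x : E) - y) with hω
    have hx : ⟪ω, (x : E)⟫ = ⟪ω, (y : E)⟫ + Real.pi := by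
      have : ⟪ω, (x : E) - y⟫ = Real.pi := by
        rw [hω, real_inner_smul_left, div_mul_cancel₀ _ hne]
      rw [inner_sub_right] at this
      linarith
    by_cases hc : Real.cos ⟪ω, (y : E)⟫ = 0
    · refine ⟨_, ⟨sinFeature S ω, sinFeature_mem_trigSpan S ω, rfl⟩, ?_⟩
      have := Real.sin_sq_add_cos_sq ⟪ω, (y : E)⟫
      simp only [sinFeature_apply, hx, Real.sin_add_pi]
      intro h
      have : Real.sin ⟪ω, (y : E)⟫ = 0 := by linarith
      simp_all
    · refine ⟨_, ⟨cosFeature S ω, cosFeature_mem_trigSpan S ω, rfl⟩, ?_⟩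
      simp only [cosFeature_apply, hx, Real.cos_add_pi]
      intro h
      exact hc (by linarith)
  have := ContinuousMap.subalgebra_topologicalClosure_eq_top_of_separatesPoints A hA
  intro f
  have hf : f ∈ A.topologicalClosure := this ▸ Algebra.mem_top
  exact hf

/-- A submodule of a normed space is dense if it is annihilated only by the zero functional. -/
lemma Submodule.dense_of_forall_dual {F : Type*} [NormedAddCommGroup F] [NormedSpace ℝ F]
    (V : Submodule ℝ F) (h : ∀ L : StrongDual ℝ F, (∀ v ∈ V, L v = 0) → L = 0) :
    Dense (V : Set F) := by
  intro x
  by_contra hx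
  obtain ⟨L, u, hL, hu⟩ := geometric_hahn_banach_closed_point
    (s := (V.topologicalClosure : Set F)) V.topologicalClosure.convex
    V.isClosed_topologicalClosure hx
  have hV : ∀ v ∈ V, L v = 0 := by
    intro v hv
    by_contra hne
    -- This multiple of `v` has `L`-value `u + 1`, above the separating bound `u`.
    have := hL (((u + 1) / L v) • v)
      (V.topologicalClosure.smul_mem _ (V.le_topologicalClosure hv))
    rw [map_smul, smul_eq_mul, div_mul_cancel₀ _ hne] at this
    linarith
  have h0 := hL 0 V.topologicalClosure.zero_mem
  rw [h L hV] at hu h0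
  simp at hu h0
  linarith

lemma cos_inner_sub (ω x y : E) : Real.cos ⟪ω, x - y⟫ =
    Real.cos ⟪ω, x⟫ * Real.cos ⟪ω, y⟫ + Real.sin ⟪ω, x⟫ * Real.sin ⟪ω, y⟫ := by
  rw [inner_sub_right, Real.cos_sub]

end Trig

/-! ### Sections of a continuous kernel -/

section Sections
variable {E : Type*} [TopologicalSpace E] {K : E → E → ℝ}

/-- A section `K(·, y)` of a continuous kernel as a continuous function on `S`. -/
noncomputable def kernelSection (hc : Continuous fun p : E × E => K p.1 p.2) (S : Set E) (y : S) :
    C(S, ℝ) :=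
  ⟨fun x => K x y, hc.comp (by fun_prop : Continuous fun x : S => ((x : E), (y : E)))⟩

lemma span_kernelSection_subset (hc : Continuous fun p : E × E => K p.1 p.2) (S : Set E) :
    (Submodule.span ℝ (Set.range (kernelSection hc S)) : Set C(S, ℝ)) ⊆ kernelSpan K S := by
  intro g hg
  obtain ⟨α, rfl⟩ := Finsupp.mem_span_range_iff_exists_finsupp.mp hg
  exact ⟨α, fun x => by simp [Finsupp.sum, kernelSection]⟩

end Sections

/-! ### Kernels with a cosine spectral representation -/

section PositiveDefinite
variable {E : Type*} [NormedAddCommGroup E] [InnerProductSpace ℝ E] [MeasurableSpace E]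
  [BorelSpace E] [SecondCountableTopology E] {μ : Measure E} [IsFiniteMeasure μ] {K : E → E → ℝ}

lemma integrable_cos_inner (μ : Measure E) [IsFiniteMeasure μ] (z : E) :
    Integrable (fun ω => Real.cos ⟪ω, z⟫) μ :=
  Integrable.of_bound (C := 1) (by fun_prop) (ae_of_all _ fun _ => Real.abs_cos_le_one _)

lemma continuous_of_eq_integral_cos (hK : ∀ x y, K x y = ∫ ω, Real.cos ⟪ω, x - y⟫ ∂μ) :
    Continuous fun p : E × E => K p.1 p.2 := by
  simp_rw [hK]
  refine continuous_of_dominated (bound := fun _ => 1) (fun p => by fun_prop)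
    (fun p => ae_of_all _ fun ω => Real.abs_cos_le_one _) (integrable_const _)
    (ae_of_all _ fun ω => by fun_prop)

lemma posSemidef_of_eq_integral_cos (hK : ∀ x y, K x y = ∫ ω, Real.cos ⟪ω, x - y⟫ ∂μ)
    (S : Set E) : (kernelMatrix K S).PosSemidef := by
  have hsymm : ∀ x y, K x y = K y x := fun x y => by
    rw [hK, hK]
    congr 1 with ω
    rw [← neg_sub, inner_neg_right, Real.cos_neg]
  have htfae : (kernelMatrix K S).PosSemidef ↔ (kernelMatrix K S).IsHermitian ∧
      ∀ v : S →₀ ℝ, 0 ≤ RCLike.re (K := ℝ)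
        (v.sum fun x w => v.sum fun x' w' => ⟪kernelMatrix K S x' x w, w'⟫) :=
    RKHS.posSemidef_tfae.out 0 2
  refine htfae.mpr ⟨?_, fun v => ?_⟩
  · ext x y
    have hid : star (ContinuousLinearMap.id ℝ ℝ) = ContinuousLinearMap.id ℝ ℝ :=
      star_one (ℝ →L[ℝ] ℝ)
    simp [hid, kernelMatrix, Matrix.conjTranspose_apply, hsymm x y]
  -- The integrand is `|∑ v x * exp(i⟪ω, x⟫)|²`, split into real and imaginary parts.
  · have hsum : (v.sum fun x w => v.sum fun x' w' => ⟪kernelMatrix K S x' x w, w'⟫) =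
        ∫ ω, ((∑ x ∈ v.support, v x * Real.cos ⟪ω, (x : E)⟫) ^ 2 +
          (∑ x ∈ v.support, v x * Real.sin ⟪ω, (x : E)⟫) ^ 2) ∂μ := by
      have : ∀ ω, ((∑ x ∈ v.support, v x * Real.cos ⟪ω, (x : E)⟫) ^ 2 +
          (∑ x ∈ v.support, v x * Real.sin ⟪ω, (x : E)⟫) ^ 2) =
          ∑ x ∈ v.support, ∑ y ∈ v.support, v x * v y * Real.cos ⟪ω, (y : E) - x⟫ := by
        intro ω
        rw [sq, sq, Finset.sum_mul_sum, Finset.sum_mul_sum, ← Finset.sum_add_distrib]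
        refine Finset.sum_congr rfl fun x _ => ?_
        rw [← Finset.sum_add_distrib]
        refine Finset.sum_congr rfl fun y _ => ?_
        rw [cos_inner_sub]
        ring
      simp_rw [this]
      rw [integral_finsetSum _ fun x _ => integrable_finsetSum _ fun y _ =>
        (integrable_cos_inner μ _).const_mul _]
      refine Finset.sum_congr rfl fun x _ => ?_
      rw [integral_finsetSum _ fun y _ => (integrable_cos_inner μ _).const_mul _]
      refine Finset.sum_congr rfl fun y _ => ?_
      rw [integral_const_mul, ← hK]
      simp [kernelMatrix]
      ring
    rw [hsum]
    exact integral_nonneg fun ω => by positivity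

/-- A kernel with spectral representation `K x y = ∫ cos ⟪ω, x - y⟫ dμ(ω)`, with `μ` of full
support, has dense span of sections in `C(S, ℝ)` for every compact `S`. -/
theorem dense_kernelSpan_of_eq_integral_cos [μ.IsOpenPosMeasure]
    (hK : ∀ x y, K x y = ∫ ω, Real.cos ⟪ω, x - y⟫ ∂μ) {S : Set E} (hS : IsCompact S) :
    Dense (kernelSpan K S) := by
  have : CompactSpace S := isCompact_iff_compactSpace.mp hS
  have hc := continuous_of_eq_integral_cos hK
  refine (Submodule.dense_of_forall_dual _ fun L hL => ?_).mono (span_kernelSection_subset hc S)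
  have hC : Continuous fun ω => L (cosFeature S ω) := L.continuous.comp (continuous_cosFeature S)
  have hD : Continuous fun ω => L (sinFeature S ω) := L.continuous.comp (continuous_sinFeature S)
  have hcn : ∀ ω, ‖cosFeature S ω‖ ≤ 1 := fun ω =>
    (ContinuousMap.norm_le _ zero_le_one).mpr fun x => Real.abs_cos_le_one _
  have hsn : ∀ ω, ‖sinFeature S ω‖ ≤ 1 := fun ω =>
    (ContinuousMap.norm_le _ zero_le_one).mpr fun x => Real.abs_sin_le_one _
  have hLc : ∀ ω, ‖L (cosFeature S ω)‖ ≤ ‖L‖ := fun ω =>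
    L.le_of_opNorm_le_of_le le_rfl (hcn ω) |>.trans (mul_one _).le
  have hLs : ∀ ω, ‖L (sinFeature S ω)‖ ≤ ‖L‖ := fun ω =>
    L.le_of_opNorm_le_of_le le_rfl (hsn ω) |>.trans (mul_one _).le
  -- integrate a bounded continuous weight against the features
  have hint : ∀ (c s : E → ℝ), Continuous c → Continuous s → ∀ C, (∀ ω, ‖c ω‖ ≤ C) →
      (∀ ω, ‖s ω‖ ≤ C) →
      Integrable (fun ω => c ω • cosFeature S ω + s ω • sinFeature S ω) μ := by
    intro c s hc hs C hcC hsC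
    have h0 : 0 ≤ C := (norm_nonneg _).trans (hcC 0)
    refine Integrable.of_bound (C := C * 1 + C * 1)
      ((hc.smul (continuous_cosFeature S)).add
        (hs.smul (continuous_sinFeature S))).aestronglyMeasurable (ae_of_all _ fun ω => ?_)
    refine (norm_add_le _ _).trans (add_le_add ?_ ?_)
    · rw [norm_smul]
      exact mul_le_mul (hcC ω) (hcn ω) (norm_nonneg _) h0
    · rw [norm_smul]
      exact mul_le_mul (hsC ω) (hsn ω) (norm_nonneg _) h0
  have hsec : ∀ y : S, kernelSection hc S y =
      ∫ ω, (Real.cos ⟪ω, (y : E)⟫ • cosFeature S ω + Real.sin ⟪ω, (y : E)⟫ • sinFeature S ω) ∂μ := by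
    intro y
    ext x
    rw [ContinuousMap.integral_apply (hint _ _ (by fun_prop) (by fun_prop) 1
      (fun _ => Real.abs_cos_le_one _) (fun _ => Real.abs_sin_le_one _))]
    change K x y = _
    rw [hK]
    congr 1 with ω
    rw [cos_inner_sub]
    simp [mul_comm]
  -- Evaluated at `y`, this integral is also `L` of the section at `y`, which vanishes by
  -- hypothesis.
  have hzero : ∫ ω, (L (cosFeature S ω) • cosFeature S ω +
      L (sinFeature S ω) • sinFeature S ω) ∂μ = 0 := by
    ext y
    rw [ContinuousMap.integral_apply (hint _ _ hC hD _ hLc hLs), ContinuousMap.zero_apply,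
      ← hL _ (Submodule.subset_span ⟨y, rfl⟩), hsec, ← L.integral_comp_comm
      (hint _ _ (by fun_prop) (by fun_prop) 1
      (fun _ => Real.abs_cos_le_one _) (fun _ => Real.abs_sin_le_one _))]
    congr 1 with ω
    simp [mul_comm]
  have hsq : ∫ ω, (L (cosFeature S ω) ^ 2 + L (sinFeature S ω) ^ 2) ∂μ = 0 := by
    rw [← map_zero L, ← hzero, ← L.integral_comp_comm (hint _ _ hC hD _ hLc hLs)]
    congr 1 with ω
    simp [sq]
  have hsqint : Integrable (fun ω => L (cosFeature S ω) ^ 2 + L (sinFeature S ω) ^ 2) μ := by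
    have := L.integrable_comp (hint _ _ hC hD _ hLc hLs)
    simpa [sq] using this
  have hae := (integral_eq_zero_iff_of_nonneg (fun ω => by positivity) hsqint).mp hsq
  have hall : (fun ω => L (cosFeature S ω) ^ 2 + L (sinFeature S ω) ^ 2) = 0 :=
    (Continuous.ae_eq_iff_eq μ ((hC.pow 2).add (hD.pow 2)) continuous_zero).mp hae
  have hcs : ∀ ω, L (cosFeature S ω) = 0 ∧ L (sinFeature S ω) = 0 := fun ω => by
    have := congrFun hall ω
    simp only [Pi.zero_apply] at this
    exact ⟨by nlinarith [sq_nonneg (L (cosFeature S ω)), sq_nonneg (L (sinFeature S ω))],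
      by nlinarith [sq_nonneg (L (cosFeature S ω)), sq_nonneg (L (sinFeature S ω))]⟩
  have hle : trigSpan S ≤ LinearMap.ker (L : C(S, ℝ) →ₗ[ℝ] ℝ) := by
    refine Submodule.span_le.mpr ?_
    rintro _ (⟨ω, rfl⟩ | ⟨ω, rfl⟩)
    · exact (hcs ω).1
    · exact (hcs ω).2
  refine DFunLike.coe_injective (Continuous.ext_on (dense_trigSpan hS) L.continuous
    continuous_zero fun f hf => hle hf)

end PositiveDefinite

/-! ### Continuity and sections in the induced RKHS -/

section RKHS
variable {E : Type*} [TopologicalSpace E] {K : E → E → ℝ} {S : Set E}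

/-- By the reproducing property `f x = ⟪k_x, f⟫`, and `x ↦ k_x` is norm-continuous since `‖k_y -
k_x‖² = K y y - 2 K x y + K x x`. -/
lemma continuous_ofKernel (hc : Continuous fun p : E × E => K p.1 p.2)
    [Fact (kernelMatrix K S).PosSemidef] (f : RKHS.OfKernel (kernelMatrix K S)) :
    Continuous fun x : S => f x := by
  have hin : ∀ x y : S, ⟪RKHS.kerFun (RKHS.OfKernel (kernelMatrix K S)) y (1 : ℝ),
      RKHS.kerFun (RKHS.OfKernel (kernelMatrix K S)) x (1 : ℝ)⟫ = K x y := fun x y => by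
    rw [← RKHS.kernel_inner, RKHS.OfKernel.kernel_ofKernel]
    simp [kernelMatrix]
  have hker : Continuous fun x : S =>
      RKHS.kerFun (RKHS.OfKernel (kernelMatrix K S)) x (1 : ℝ) := by
    refine continuous_iff_continuousAt.mpr fun x => ?_
    refine tendsto_iff_norm_sub_tendsto_zero.mpr ?_
    have hn : ∀ y : S, ‖RKHS.kerFun (RKHS.OfKernel (kernelMatrix K S)) y (1 : ℝ) -
        RKHS.kerFun (RKHS.OfKernel (kernelMatrix K S)) x (1 : ℝ)‖ =
        √(K y y - 2 * K x y + K x x) := fun y => by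
      rw [← hin, ← hin, ← hin, real_inner_self_eq_norm_sq, real_inner_self_eq_norm_sq,
        ← norm_sub_sq_real, Real.sqrt_sq (norm_nonneg _)]
    simp_rw [hn]
    have h1 : Continuous fun y : S => K y y :=
      hc.comp (by fun_prop : Continuous fun y : S => ((y : E), (y : E)))
    have h2 : Continuous fun y : S => K x y :=
      hc.comp (by fun_prop : Continuous fun y : S => ((x : E), (y : E)))
    have h3 : Continuous fun y : S => √(K y y - 2 * K x y + K x x) := by fun_prop
    convert h3.tendsto x using 2
    rw [show K x x - 2 * K x x + K x x = 0 by ring, Real.sqrt_zero]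
  have : (fun x : S => f x) = fun x : S =>
      ⟪RKHS.kerFun (RKHS.OfKernel (kernelMatrix K S)) x (1 : ℝ), f⟫ := by
    ext x
    simp
  rw [this]
  exact hker.inner continuous_const

lemma kernelSpan_subset_rkhsFunctions (hK : (kernelMatrix K S).PosSemidef) :
    kernelSpan K S ⊆ rkhsFunctions K S hK := by
  rintro g ⟨α, hα⟩
  have : Fact (kernelMatrix K S).PosSemidef := ⟨hK⟩
  refine ⟨α.sum fun y c => c • RKHS.kerFun (RKHS.OfKernel (kernelMatrix K S)) y (1 : ℝ),
    fun x => ?_⟩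
  rw [hα, ← RKHS.coeCLM_apply (𝕜 := ℝ), Finsupp.sum, Finsupp.sum, map_sum, Finset.sum_apply]
  refine Finset.sum_congr rfl fun y _ => ?_
  rw [RKHS.coeCLM_apply, RKHS.coe_smul, Pi.smul_apply, RKHS.kerFun_apply,
    RKHS.OfKernel.kernel_ofKernel]
  simp [kernelMatrix]

end RKHS

theorem isUniversalKernel_of_eq_integral_cos {E : Type*} [NormedAddCommGroup E]
    [InnerProductSpace ℝ E] [MeasurableSpace E] [BorelSpace E] [SecondCountableTopology E]
    {μ : Measure E} [IsFiniteMeasure μ] [μ.IsOpenPosMeasure] {K : E → E → ℝ}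
    (hK : ∀ x y, K x y = ∫ ω, Real.cos ⟪ω, x - y⟫ ∂μ) : IsUniversalKernel K := by
  have hc := continuous_of_eq_integral_cos hK
  refine ⟨hc, fun S hS => ⟨posSemidef_of_eq_integral_cos hK S, ?_, ?_⟩⟩
  · have : Fact (kernelMatrix K S).PosSemidef := ⟨posSemidef_of_eq_integral_cos hK S⟩
    exact continuous_ofKernel hc
  · exact (dense_kernelSpan_of_eq_integral_cos hK hS).mono (kernelSpan_subset_rkhsFunctions _)

/-! ### The triangle function and its Fourier transform -/

/-- The triangle function of half-width `r` and height `1`. -/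
noncomputable def triangle (r t : ℝ) : ℝ := max 0 (1 - |t| / r)

lemma continuous_triangle (r : ℝ) : Continuous (triangle r) := by
  unfold triangle; fun_prop

lemma triangle_nonneg (r t : ℝ) : 0 ≤ triangle r t := le_max_left _ _

lemma triangle_of_le_abs {r t : ℝ} (hr : 0 < r) (h : r ≤ |t|) : triangle r t = 0 :=
  max_eq_left (by rw [sub_nonpos, le_div_iff₀ hr]; linarith)

lemma triangle_of_abs_le {r t : ℝ} (hr : 0 < r) (h : |t| ≤ r) : triangle r t = 1 - |t| / r :=
  max_eq_right (by rw [sub_nonneg, div_le_iff₀ hr]; linarith)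

lemma integrable_triangle {r : ℝ} (hr : 0 < r) : Integrable (fun t => (triangle r t : ℂ)) := by
  refine Continuous.integrable_of_hasCompactSupport
    (Complex.continuous_ofReal.comp (continuous_triangle r))
    (HasCompactSupport.intro (isCompact_Icc (a := -r) (b := r)) fun t ht => ?_)
  rw [Set.mem_Icc, ← abs_le, not_le] at ht
  simp [triangle_of_le_abs hr ht.le]

/-- Integration by parts gives the antiderivative. The two halves of the Fourier integral are the
cases `c = ±2πis`. -/
lemma integral_one_sub_div_mul_cexp {r : ℝ} (hr : 0 < r) {c : ℂ} (hc : c ≠ 0) :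
    ∫ t in (0 : ℝ)..r, (1 - (t : ℂ) / r) * Complex.exp (-c * t) =
      Complex.exp (-c * r) / (r * c ^ 2) + 1 / c - 1 / (r * c ^ 2) := by
  have hr' : (r : ℂ) ≠ 0 := by exact_mod_cast hr.ne'
  have hd : ∀ t : ℝ, HasDerivAt (fun t : ℝ => -(1 - (t : ℂ) / r) * Complex.exp (-c * t) / c +
      Complex.exp (-c * t) / (r * c ^ 2)) ((1 - (t : ℂ) / r) * Complex.exp (-c * t)) t := by
    intro t
    have h1 : HasDerivAt (fun t : ℝ => (t : ℂ)) 1 t := Complex.ofRealCLM.hasDerivAt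
    have h2 : HasDerivAt (fun t : ℝ => Complex.exp (-c * t)) (Complex.exp (-c * t) * (-c * 1)) t :=
      (h1.const_mul (-c)).cexp
    have h3 := ((((h1.div_const (r : ℂ)).const_sub 1).neg.mul h2).div_const c).add
      (h2.div_const ((r : ℂ) * c ^ 2))
    refine h3.congr_deriv ?_
    simp only [Pi.neg_apply]
    field_simp
    ring
  rw [intervalIntegral.integral_eq_sub_of_hasDerivAt (fun t _ => hd t)
    (Continuous.intervalIntegrable (by fun_prop) _ _)]
  simp [hr']
  ring

lemma fourier_triangle {r : ℝ} (hr : 0 < r) {s : ℝ} (hs : s ≠ 0) :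
    𝓕 (fun t => (triangle r t : ℂ)) s =
      (((1 - Real.cos (2 * Real.pi * s * r)) / (2 * Real.pi ^ 2 * s ^ 2 * r) : ℝ) : ℂ) := by
  have hcont : Continuous fun t : ℝ => Complex.exp (↑(-2 * Real.pi * t * s) * Complex.I) •
      (triangle r t : ℂ) :=
    (by fun_prop : Continuous fun t : ℝ => Complex.exp (↑(-2 * Real.pi * t * s) * Complex.I)).smul
      (Complex.continuous_ofReal.comp (continuous_triangle r))
  rw [Real.fourier_real_eq_integral_exp_smul]
  set c : ℂ := 2 * Real.pi * s * Complex.I with hcdef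
  have hc : c ≠ 0 := by
    simp [hcdef, hs, Real.pi_ne_zero]
  have hsupp : ∫ t : ℝ, Complex.exp (↑(-2 * Real.pi * t * s) * Complex.I) • (triangle r t : ℂ) =
      ∫ t in (-r)..r, Complex.exp (↑(-2 * Real.pi * t * s) * Complex.I) • (triangle r t : ℂ) := by
    rw [intervalIntegral.integral_of_le (by linarith), ← integral_Icc_eq_integral_Ioc,
      setIntegral_eq_integral_of_forall_compl_eq_zero]
    intro t ht
    rw [Set.mem_Icc, ← abs_le, not_le] at ht
    simp [triangle_of_le_abs hr ht.le]
  have hpos : ∫ t in (0 : ℝ)..r, Complex.exp (↑(-2 * Real.pi * t * s) * Complex.I) •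
      (triangle r t : ℂ) = ∫ t in (0 : ℝ)..r, (1 - (t : ℂ) / r) * Complex.exp (-c * t) := by
    refine intervalIntegral.integral_congr fun t ht => ?_
    rw [Set.uIcc_of_le hr.le] at ht
    have hta : |t| = t := abs_of_nonneg ht.1
    rw [triangle_of_abs_le hr (hta.trans_le ht.2), hta, smul_eq_mul, mul_comm]
    push_cast
    congr 2
    rw [hcdef]; ring
  have hneg : ∫ t in (-r)..0, Complex.exp (↑(-2 * Real.pi * t * s) * Complex.I) •
      (triangle r t : ℂ) = ∫ t in (0 : ℝ)..r, (1 - (t : ℂ) / r) * Complex.exp (-(-c) * t) := by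
    rw [← neg_zero, ← intervalIntegral.integral_comp_neg, neg_zero]
    refine intervalIntegral.integral_congr fun t ht => ?_
    rw [Set.uIcc_of_le hr.le] at ht
    have hta : |-t| = t := by rw [abs_neg, abs_of_nonneg ht.1]
    rw [triangle_of_abs_le hr (hta.trans_le ht.2), hta, smul_eq_mul, mul_comm]
    push_cast
    congr 2
    rw [hcdef]; ring
  rw [hsupp, ← intervalIntegral.integral_add_adjacent_intervals (b := 0)
    (hcont.intervalIntegrable _ _) (hcont.intervalIntegrable _ _), hpos, hneg,
    integral_one_sub_div_mul_cexp hr hc, integral_one_sub_div_mul_cexp hr (neg_ne_zero.mpr hc)]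
  have hcos : 2 * Complex.cos (2 * Real.pi * s * r) =
      Complex.exp (c * r) + Complex.exp (-c * r) := by
    rw [Complex.two_cos, hcdef]
    congr 2 <;> ring
  have hc2 : c ^ 2 = -(4 * Real.pi ^ 2 * s ^ 2) := by
    rw [hcdef, mul_pow, Complex.I_sq]; ring
  have hr' : (r : ℂ) ≠ 0 := by exact_mod_cast hr.ne'
  have hs' : (s : ℂ) ≠ 0 := by exact_mod_cast hs
  have hpi : (Real.pi : ℂ) ≠ 0 := by exact_mod_cast Real.pi_ne_zero
  -- Eliminating one exponential lets the other cancel algebraically, leaving only the cosine.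
  have hE : Complex.exp (c * r) = 2 * Complex.cos (2 * Real.pi * s * r) - Complex.exp (-c * r) := by
    rw [hcos]; ring
  push_cast
  rw [neg_neg, hE, neg_sq, one_div, one_div, one_div, hc2, inv_neg]
  field_simp
  ring

/-- The spectral density of the triangle function. -/
noncomputable def triangleDensity (r s : ℝ) : ℝ := (𝓕 (fun t => (triangle r t : ℂ)) s).re

lemma continuous_fourier_triangle {r : ℝ} (hr : 0 < r) :
    Continuous (𝓕 (fun t => (triangle r t : ℂ))) :=
  VectorFourier.fourierIntegral_continuous Real.continuous_fourierChar
    (by exact continuous_inner) (integrable_triangle hr)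

lemma continuous_triangleDensity {r : ℝ} (hr : 0 < r) : Continuous (triangleDensity r) :=
  Complex.continuous_re.comp (continuous_fourier_triangle hr)

lemma triangleDensity_eq {r : ℝ} (hr : 0 < r) {s : ℝ} (hs : s ≠ 0) : triangleDensity r s =
    (1 - Real.cos (2 * Real.pi * s * r)) / (2 * Real.pi ^ 2 * s ^ 2 * r) := by
  rw [triangleDensity, fourier_triangle hr hs, Complex.ofReal_re]

/-- The closed formula shows the transform is real off `0`; continuity extends this to `0`. -/
lemma fourier_triangle_eq_triangleDensity {r : ℝ} (hr : 0 < r) (s : ℝ) :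
    𝓕 (fun t => (triangle r t : ℂ)) s = triangleDensity r s := by
  have h1 : Set.EqOn (𝓕 (fun t => (triangle r t : ℂ))) (fun s => (triangleDensity r s : ℂ))
      {0}ᶜ := fun s hs => by
    have hs : s ≠ 0 := hs
    simp only
    rw [triangleDensity_eq hr hs, fourier_triangle hr hs]
  exact congrFun (Continuous.ext_on (dense_compl_singleton 0) (continuous_fourier_triangle hr)
    (Complex.continuous_ofReal.comp (continuous_triangleDensity hr)) h1) s

lemma triangleDensity_nonneg {r : ℝ} (hr : 0 < r) (s : ℝ) : 0 ≤ triangleDensity r s := by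
  have : closure ({0}ᶜ : Set ℝ) ⊆ {s | 0 ≤ triangleDensity r s} :=
    closure_minimal (fun s hs => by
      have hs : s ≠ 0 := hs
      change 0 ≤ triangleDensity r s
      rw [triangleDensity_eq hr hs]
      exact div_nonneg (by linarith [Real.cos_le_one (2 * Real.pi * s * r)]) (by positivity))
    (isClosed_le continuous_const (continuous_triangleDensity hr))
  exact this ((dense_compl_singleton (0 : ℝ)) s)

lemma integrable_triangleDensity {r : ℝ} (hr : 0 < r) : Integrable (triangleDensity r) := by
  obtain ⟨C, hC⟩ := (isCompact_Icc (a := (-1 : ℝ)) (b := 1)).exists_bound_of_continuousOn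
    (continuous_triangleDensity hr).continuousOn
  have hC0 : 0 ≤ C := (norm_nonneg _).trans (hC 0 (by simp))
  -- `2 * C` serves `|s| ≤ 1`, where `1 + s² ≤ 2`; the other term serves `|s| > 1`, where `1 - cos ≤
  -- 2` and `1 + s² ≤ 2s²`.
  have hint : Integrable fun s : ℝ => (2 * C + 2 / (Real.pi ^ 2 * r)) * (1 + s ^ 2)⁻¹ :=
    integrable_inv_one_add_sq.const_mul _
  refine hint.mono' (continuous_triangleDensity hr).aestronglyMeasurable (ae_of_all _ fun s => ?_)
  have hA : 0 ≤ 2 / (Real.pi ^ 2 * r) := by positivity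
  rw [← div_eq_mul_inv, le_div_iff₀ (by positivity)]
  by_cases hs : |s| ≤ 1
  · have h1 := hC s (abs_le.mp hs)
    have h2 : s ^ 2 ≤ 1 := (sq_le_one_iff_abs_le_one s).mpr hs
    nlinarith [norm_nonneg (triangleDensity r s), sq_nonneg s]
  · have hs1 : 1 ≤ s ^ 2 := by
      rw [← sq_abs]; nlinarith [not_le.mp hs]
    have hs0 : s ≠ 0 := by rintro rfl; simp at hs
    rw [Real.norm_of_nonneg (triangleDensity_nonneg hr s), triangleDensity_eq hr hs0]
    have hb : (1 - Real.cos (2 * Real.pi * s * r)) / (2 * Real.pi ^ 2 * s ^ 2 * r) * (1 + s ^ 2) ≤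
        2 / (2 * Real.pi ^ 2 * s ^ 2 * r) * (2 * s ^ 2) := by
      gcongr
      · linarith [Real.neg_one_le_cos (2 * Real.pi * s * r)]
      · linarith
    have hb' : 2 / (2 * Real.pi ^ 2 * s ^ 2 * r) * (2 * s ^ 2) = 2 / (Real.pi ^ 2 * r) := by
      field_simp
    linarith

/-- At this frequency the cosine is `cos π = -1`. One nonzero point of positivity suffices for full
support of the spectral measure. -/
lemma triangleDensity_pos {r : ℝ} (hr : 0 < r) : 0 < triangleDensity r (1 / (2 * r)) := by
  rw [triangleDensity_eq hr (by positivity),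
    show 2 * Real.pi * (1 / (2 * r)) * r = Real.pi by field_simp, Real.cos_pi]
  positivity

/-- The triangle function is positive definite: it is a nonnegative superposition of cosines. -/
lemma triangle_eq_integral_cos {r : ℝ} (hr : 0 < r) (t : ℝ) :
    triangle r t = ∫ s, triangleDensity r s * Real.cos (2 * Real.pi * s * t) := by
  have hF : 𝓕 (fun t => (triangle r t : ℂ)) = fun s => (triangleDensity r s : ℂ) :=
    funext (fourier_triangle_eq_triangleDensity hr)
  have hFi : Integrable fun s => (triangleDensity r s : ℂ) := (integrable_triangleDensity hr).ofReal
  have hinv := congrFun (Continuous.fourierInv_fourier_eq (f := fun t => (triangle r t : ℂ))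
    (Complex.continuous_ofReal.comp (continuous_triangle r)) (integrable_triangle hr)
    (hF ▸ hFi)) t
  rw [hF, Real.fourierInv_eq'] at hinv
  have hre := congrArg Complex.re hinv
  simp only [Complex.ofReal_re] at hre
  rw [← hre, ← RCLike.re_eq_complex_re, ← integral_re]
  · congr 1 with s
    rw [RCLike.re_eq_complex_re, smul_eq_mul, Complex.re_mul_ofReal, Complex.exp_ofReal_mul_I_re,
      mul_comm, real_inner_comm, RCLike.inner_apply, conj_trivial]
    congr 2
    ring
  · refine hFi.bdd_mul (c := 1) (by fun_prop) (ae_of_all _ fun s => ?_)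
    rw [Complex.norm_exp_ofReal_mul_I]

/-! ### Gaussian support and the collision probability -/

lemma isOpenPosMeasure_gaussianReal (m : ℝ) {v : NNReal} (hv : v ≠ 0) :
    (ProbabilityTheory.gaussianReal m v).IsOpenPosMeasure :=
  (ProbabilityTheory.gaussianReal_absolutelyContinuous' m hv).isOpenPosMeasure

lemma isOpenPosMeasure_stdGaussian (ι : Type*) [Fintype ι] :
    (ProbabilityTheory.stdGaussian (EuclideanSpace ℝ ι)).IsOpenPosMeasure := by
  have := isOpenPosMeasure_gaussianReal 0 one_ne_zero
  rw [← ProbabilityTheory.map_pi_eq_stdGaussian]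
  exact (PiLp.continuous_toLp 2 _).isOpenPosMeasure_map (WithLp.toLp_surjective 2)

/-- Two points at signed distance `u - v` fall into the same cell of a uniformly shifted grid of
width `r` with probability `triangle r (u - v)`. -/
lemma cond_floor_eq_floor {r : ℝ} (hr : 0 < r) (u v : ℝ) :
    ProbabilityTheory.cond volume (Set.Icc 0 r) {b | ⌊(u + b) / r⌋ = ⌊(v + b) / r⌋} =
      ENNReal.ofReal (triangle r (u - v)) := by
  set A : Set ℝ := {b | ⌊(u + b) / r⌋ = ⌊(v + b) / r⌋} with hA
  have hmeas : MeasurableSet A := measurableSet_eq_fun (by fun_prop) (by fun_prop)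
  have hper : Function.Periodic (A.indicator (1 : ℝ → ℝ)) r := by
    intro b
    have hmem : b + r ∈ A ↔ b ∈ A := by
      have h : ∀ w, (w + (b + r)) / r = (w + b) / r + 1 := fun w => by field_simp; ring
      simp only [hA, Set.mem_ofPred_eq, h, Int.floor_add_one, add_left_inj]
    by_cases hb : b ∈ A
    · rw [Set.indicator_of_mem hb, Set.indicator_of_mem (hmem.mpr hb)]; rfl
    · rw [Set.indicator_of_notMem hb, Set.indicator_of_notMem (mt hmem.mp hb)]
  -- Periodicity moves the window to `[-u, -u + r)`, where the cell index of `u + b` is always `0`.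
  have hvol : volume.real (A ∩ Set.Icc 0 r) = volume.real (A ∩ Set.Ico (-u) (-u + r)) := by
    have h := hper.intervalIntegral_add_eq 0 (-u)
    rw [zero_add, intervalIntegral.integral_of_le hr.le,
      intervalIntegral.integral_of_le (by linarith), ← integral_Icc_eq_integral_Ioc,
      ← integral_Ico_eq_integral_Ioc, integral_indicator_one hmeas, integral_indicator_one hmeas,
      measureReal_restrict_apply hmeas, measureReal_restrict_apply hmeas] at h
    exact h
  have hset : A ∩ Set.Ico (-u) (-u + r) = Set.Ico (max (-u) (-v)) (min (r - u) (r - v)) := by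
    ext b
    simp only [hA, Set.mem_inter_iff, Set.mem_ofPred_eq, Set.mem_Ico, max_le_iff, lt_min_iff]
    have hfl : ∀ w, ⌊(w + b) / r⌋ = 0 ↔ 0 ≤ w + b ∧ w + b < r := fun w => by
      rw [Int.floor_eq_zero_iff, Set.mem_Ico, div_lt_one hr, div_nonneg_iff]
      constructor
      · rintro ⟨h | h, h'⟩
        · exact ⟨h.1, h'⟩
        · linarith
      · exact fun h => ⟨Or.inl ⟨h.1, hr.le⟩, h.2⟩
    constructor
    · rintro ⟨h, h1, h2⟩
      have hu : ⌊(u + b) / r⌋ = 0 := (hfl u).mpr ⟨by linarith, by linarith⟩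
      obtain ⟨h3, h4⟩ := (hfl v).mp (h ▸ hu)
      exact ⟨⟨h1, by linarith⟩, by linarith, by linarith⟩
    · rintro ⟨⟨h1, h2⟩, h3, h4⟩
      exact ⟨((hfl u).mpr ⟨by linarith, by linarith⟩).trans
        ((hfl v).mpr ⟨by linarith, by linarith⟩).symm, h1, by linarith⟩
  have hlen : min (r - u) (r - v) - max (-u) (-v) = r * (1 - |u - v| / r) := by
    rw [mul_sub, mul_one, mul_div_cancel₀ _ hr.ne']
    rcases le_total u v with h | h
    · rw [min_eq_right (by linarith), max_eq_left (by linarith), abs_of_nonpos (by linarith)]; ring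
    · rw [min_eq_left (by linarith), max_eq_right (by linarith), abs_of_nonneg (by linarith)]; ring
  rw [ProbabilityTheory.cond_apply measurableSet_Icc, Real.volume_Icc, sub_zero, Set.inter_comm,
    ← ofReal_measureReal (by
      exact ((measure_mono Set.inter_subset_right).trans_lt measure_Icc_lt_top).ne), hvol, hset,
    measureReal_def, Real.volume_Ico, hlen, ENNReal.toReal_ofReal', ← ENNReal.ofReal_inv_of_pos hr,
    ← ENNReal.ofReal_mul (inv_nonneg.mpr hr.le), triangle, max_comm]
  congr 1
  rw [← mul_zero r, ← mul_max_of_nonneg _ _ hr.le, mul_zero, inv_mul_cancel_left₀ hr.ne']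

lemma l2LSHKernel_eq_integral_triangle (d : ℕ) {r : ℝ} (hr : 0 < r)
    (x y : EuclideanSpace ℝ (Fin d)) : l2LSHKernel d r x y =
      ∫ a, triangle r ⟪a, x - y⟫ ∂ProbabilityTheory.stdGaussian (EuclideanSpace ℝ (Fin d)) := by
  have hm : MeasurableSet {p : EuclideanSpace ℝ (Fin d) × ℝ |
      l2Hash r p.1 p.2 x = l2Hash r p.1 p.2 y} := by
    unfold l2Hash
    exact measurableSet_eq_fun (by fun_prop) (by fun_prop)
  have : IsProbabilityMeasure (ProbabilityTheory.cond volume (Set.Icc 0 r)) :=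
    ProbabilityTheory.cond_isProbabilityMeasure_of_finite (by simp [hr]) (by simp)
  rw [l2LSHKernel, l2HashLaw, measureReal_def, Measure.prod_apply hm,
    integral_eq_lintegral_of_nonneg_ae (ae_of_all _ fun _ => triangle_nonneg _ _)
    ((continuous_triangle r).comp (by fun_prop)).aestronglyMeasurable]
  congr 1
  refine lintegral_congr fun a => ?_
  rw [inner_sub_right, ← cond_floor_eq_floor hr]
  rfl

/-! ### The spectral measure of the kernel -/

/-- The spectral measure of the L2 LSH kernel: the law of `(2πs) a` for `a` standard normal and `s`
distributed according to the spectral density of the triangle function. -/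
noncomputable def l2LSHSpectralMeasure (d : ℕ) (r : ℝ) : Measure (EuclideanSpace ℝ (Fin d)) :=
  ((volume.withDensity fun s => ENNReal.ofReal (triangleDensity r s)).prod
    (ProbabilityTheory.stdGaussian (EuclideanSpace ℝ (Fin d)))).map
      fun p => (2 * Real.pi * p.1) • p.2

lemma isFiniteMeasure_triangleDensity {r : ℝ} (hr : 0 < r) :
    IsFiniteMeasure (volume.withDensity fun s => ENNReal.ofReal (triangleDensity r s)) :=
  isFiniteMeasure_withDensity_ofReal (integrable_triangleDensity hr).2

lemma isFiniteMeasure_l2LSHSpectralMeasure (d : ℕ) {r : ℝ} (hr : 0 < r) :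
    IsFiniteMeasure (l2LSHSpectralMeasure d r) := by
  have := isFiniteMeasure_triangleDensity hr
  unfold l2LSHSpectralMeasure
  infer_instance

lemma isOpenPosMeasure_l2LSHSpectralMeasure (d : ℕ) {r : ℝ} (hr : 0 < r) :
    (l2LSHSpectralMeasure d r).IsOpenPosMeasure := by
  have := isOpenPosMeasure_stdGaussian (Fin d)
  have := isFiniteMeasure_triangleDensity hr
  refine ⟨fun U hU ⟨ω, hω⟩ => ?_⟩
  have hcont : Continuous fun p : ℝ × EuclideanSpace ℝ (Fin d) => (2 * Real.pi * p.1) • p.2 := by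
    fun_prop
  rw [l2LSHSpectralMeasure, Measure.map_apply hcont.measurable hU.measurableSet]
  set s₀ : ℝ := 1 / (2 * r)
  have hs₀ : 2 * Real.pi * s₀ ≠ 0 := by positivity
  -- A preimage of `ω` at the frequency `s₀` of positive density; a product neighbourhood of it has
  -- positive mass.
  have hmem : (s₀, (2 * Real.pi * s₀)⁻¹ • ω) ∈
      (fun p : ℝ × EuclideanSpace ℝ (Fin d) => (2 * Real.pi * p.1) • p.2) ⁻¹' U := by
    rwa [Set.mem_preimage, smul_smul, mul_inv_cancel₀ hs₀, one_smul]
  obtain ⟨V, W, hV, hW, hsV, haW, hVW⟩ := isOpen_prod_iff.mp (hU.preimage hcont) _ _ hmem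
  refine fun h0 => ?_
  have hz := measure_mono_null hVW h0
  rw [Measure.prod_prod, mul_eq_zero] at hz
  rcases hz with hz | hz
  · rw [withDensity_apply _ hV.measurableSet, setLIntegral_eq_zero_iff hV.measurableSet
      (continuous_triangleDensity hr).measurable.ennreal_ofReal] at hz
    set P : Set ℝ := V ∩ {s | 0 < triangleDensity r s}
    have hP : IsOpen P := hV.inter (isOpen_lt continuous_const (continuous_triangleDensity hr))
    refine hP.measure_ne_zero volume ⟨s₀, hsV, triangleDensity_pos hr⟩
      (measure_mono_null (fun s hs => ?_) hz)
    intro h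
    exact absurd (ENNReal.ofReal_eq_zero.mp (h hs.1)) (not_le.mpr hs.2)
  · exact hW.measure_ne_zero _ ⟨_, haW⟩ hz

/-- Insert the cosine representation of the triangle at `t = ⟪a, x - y⟫` and apply Fubini. -/
lemma l2LSHKernel_eq_integral_cos (d : ℕ) {r : ℝ} (hr : 0 < r) (x y : EuclideanSpace ℝ (Fin d)) :
    l2LSHKernel d r x y = ∫ ω, Real.cos ⟪ω, x - y⟫ ∂l2LSHSpectralMeasure d r := by
  have := isFiniteMeasure_triangleDensity hr
  rw [l2LSHKernel_eq_integral_triangle d hr, l2LSHSpectralMeasure,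
    integral_map (by fun_prop) (by fun_prop), integral_prod_symm]
  · refine integral_congr_ae (ae_of_all _ fun a => ?_)
    simp only
    rw [triangle_eq_integral_cos hr, integral_withDensity_eq_integral_toReal_smul
      (continuous_triangleDensity hr).measurable.ennreal_ofReal
      (ae_of_all _ fun _ => ENNReal.ofReal_lt_top)]
    refine integral_congr_ae (ae_of_all _ fun s => ?_)
    simp only
    rw [ENNReal.toReal_ofReal (triangleDensity_nonneg hr s), real_inner_smul_left, smul_eq_mul]
  · exact Integrable.of_bound (C := 1) (by fun_prop) (ae_of_all _ fun _ => Real.abs_cos_le_one _)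

theorem lemma2 (d : ℕ) (r : ℝ) (hr : 0 < r) :
    IsShiftInvariantKernel (l2LSHKernel d r) ∧
    IsUniversalKernel (l2LSHKernel d r) ∧
    ∀ S : Set (EuclideanSpace ℝ (Fin d)), IsCompact S →
      Dense (kernelSpan (l2LSHKernel d r) S) := by
  have hK := l2LSHKernel_eq_integral_cos d hr
  have := isFiniteMeasure_l2LSHSpectralMeasure d hr
  have := isOpenPosMeasure_l2LSHSpectralMeasure d hr
  exact ⟨⟨fun z => ∫ a, triangle r ⟪a, z⟫ ∂ProbabilityTheory.stdGaussian _,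
    l2LSHKernel_eq_integral_triangle d hr⟩, isUniversalKernel_of_eq_integral_cos hK,
    fun S hS => dense_kernelSpan_of_eq_integral_cos hK hS⟩
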